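/- **Proposition 6.5 (Existence of strict wedge subspaces).** Let $X$ be a compact complex manifold and let $D$ be a reduced snc divisor on $X$. Write $\Omega^p_X(\log D)$ for the sheaf of holomorphic $p$-forms with logarithmic poles along $D$. For $k \in \mathbb{N}$, a linear subspace $W \subseteq H^0(X, \Omega^1_X(\log D))$ is called a *strict $k$-wedge subspace* if $\dim W > k$, the natural map $\Lambda^k W \to H^0(X, \Omega^k_X(\log D))$ is injective, and the natural map $\Lambda^{k+1} W \to H^0(X, \Omega^{k+1}_X(\log D))$ is identically zero. Let $V \subseteq H^0(X, \Omega^1_X(\log D))$ be a linear subspace with $\dim V > \dim X$. Then there exist an integer $k \geq 1$ and a strict $k$-wedge subspace $V' \subseteq V$ with $\dim V' = k+1$. -/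

import Mathlib

open scoped Manifold ContDiff

noncomputable section

namespace LogForms

/-- The model space `ℂⁿ` of `n`-dimensional complex manifolds. -/
abbrev Model (n : ℕ) : Type := EuclideanSpace ℂ (Fin n)

variable {n : ℕ} {X : Type*} [TopologicalSpace X] [ChartedSpace (Model n) X]

/-- Holomorphic coordinates `(z_0, …, z_{n-1})` on an open subset of `X` (a chart of the maximal
holomorphic atlas) in which the sets `C ∈ S` that meet the coordinate domain are pairwise distinct
coordinate hyperplanes `{z_i = 0}`. -/
structure AdaptedChart (n : ℕ) {X : Type*} [TopologicalSpace X] [ChartedSpace (Model n) X]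
    (S : Set (Set X)) where
  /-- The coordinate system. -/
  chart : OpenPartialHomeomorph X (Model n)
  /-- The coordinates are holomorphic. -/
  mem_maximalAtlas : chart ∈ IsManifold.maximalAtlas 𝓘(ℂ, Model n) ω X
  /-- The coordinate that cuts out a given member of `S`. -/
  index : {C : Set X // C ∈ S ∧ (C ∩ chart.source).Nonempty} ↪ Fin n
  /-- In the coordinate domain, `C` is the hyperplane `{z_i = 0}`, where `i = index C`. -/
  inter_source : ∀ C, C.1 ∩ chart.source = {x ∈ chart.source | chart x (index C) = 0}

variable (n X) in
/-- A reduced snc divisor `D = ∑ D_i` on the `n`-dimensional complex manifold `X`, given by the set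
of its prime components `D_i`. Near every point of `X` there are holomorphic coordinates in which
the `D_i` are distinct coordinate hyperplanes; hence the `D_i` are closed complex submanifolds of
codimension one, locally finite in number, and for such hypersurfaces irreducible means
connected. -/
structure ReducedSNCDivisor where
  /-- The prime components of the divisor. -/
  components : Set (Set X)
  /-- The components are non-empty and irreducible. -/
  isConnected : ∀ C ∈ components, IsConnected C
  /-- Simple normal crossings. -/
  exists_adaptedChart : ∀ x : X, ∃ e : AdaptedChart n components, x ∈ e.chart.source

/-- The support of the divisor, the union of its components. -/
def ReducedSNCDivisor.support (D : ReducedSNCDivisor n X) : Set X := ⋃₀ D.components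

variable (n) in
/-- Not necessarily continuous differential `p`-forms on a subset `U` of `X`: families of
alternating `p`-forms on the tangent spaces. -/
abbrev RoughForm {X : Type*} [TopologicalSpace X] [ChartedSpace (Model n) X]
    (U : Set X) (p : ℕ) : Type _ :=
  ∀ x : U, (TangentSpace 𝓘(ℂ, Model n) (x : X)) [⋀^Fin p]→ₗ[ℂ] ℂ

namespace AdaptedChart

variable {S : Set (Set X)} (e : AdaptedChart n S)

/-- The coordinate vector field `∂/∂z_i`, at the point with coordinates `z`. -/
def coordField (i : Fin n) (z : Model n) :
    TangentSpace 𝓘(ℂ, Model n) (e.chart.symm z) :=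
  mfderiv 𝓘(ℂ, Model n) 𝓘(ℂ, Model n) e.chart.symm z
    (EuclideanSpace.single i (1 : ℂ) : Model n)

open Classical in
/-- The logarithmic coordinate vector fields: `z_i ∂/∂z_i` if `{z_i = 0}` is a component of the
divisor, and `∂/∂z_i` otherwise. Where the `z_i` of the first kind do not vanish, this frame is
dual to the frame consisting of the `dz_i / z_i` for `i` of the first kind and of the `dz_i` for
all other `i`. -/
def logField (i : Fin n) (z : Model n) : TangentSpace 𝓘(ℂ, Model n) (e.chart.symm z) :=
  if i ∈ Set.range e.index then z i • e.coordField i z else e.coordField i z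

end AdaptedChart

/-- A `p`-form `φ` on `X ∖ D` has logarithmic poles along `D`, that is, it is a global section of
`Ω^p_X(log D)`, if in all adapted coordinates it is `∑_I f_I δ_{I 1} ∧ ⋯ ∧ δ_{I p}` outside of `D`
(sum over increasing `I`), where the `f_I` are holomorphic on the whole coordinate domain and `δ_i` is `dz_i / z_i` if
`{z_i = 0}` is a component of `D`, and `dz_i` otherwise. The coefficient `f_I` is the value of `φ`
on the dual logarithmic vector fields with indices `I 1, …, I p`. -/
def HasLogPoles (D : ReducedSNCDivisor n X) {p : ℕ} (φ : RoughForm n (D.supportᶜ) p) : Prop :=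
  ∀ (e : AdaptedChart n D.components) (I : Fin p → Fin n),
    ∃ f : Model n → ℂ, DifferentiableOn ℂ f e.chart.target ∧
      ∀ z ∈ e.chart.target, ∀ hz : e.chart.symm z ∈ D.supportᶜ,
        φ ⟨e.chart.symm z, hz⟩ (fun a => e.logField (I a) z) = f z

/-- The complex vector space `H⁰(X, Ω^p_X(log D))` of global logarithmic `p`-forms. -/
def logForms (D : ReducedSNCDivisor n X) (p : ℕ) : Submodule ℂ (RoughForm n (D.supportᶜ) p) where
  carrier := {φ | HasLogPoles D φ}
  zero_mem' := fun _ _ => ⟨0, differentiableOn_const 0, fun _ _ _ => rfl⟩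
  add_mem' := by
    intro φ η hφ hη e I
    obtain ⟨f, hf, hf'⟩ := hφ e I
    obtain ⟨g, hg, hg'⟩ := hη e I
    refine ⟨f + g, hf.add hg, fun z hz hz' => ?_⟩
    simp [← hf' z hz hz', ← hg' z hz hz']
  smul_mem' := by
    intro c φ hφ e I
    obtain ⟨f, hf, hf'⟩ := hφ e I
    refine ⟨c • f, hf.const_smul c, fun z hz hz' => ?_⟩
    simp [← hf' z hz hz']

/-- The wedge product of `k` linear forms `α i` on a vector space:
`(α 0 ∧ ⋯ ∧ α (k - 1)) (v 0, …, v (k - 1)) = det (α i (v j))`. -/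
def pointwiseWedge {T : Type*} [AddCommGroup T] [Module ℂ T] {k : ℕ}
    (α : Fin k → T [⋀^Fin 1]→ₗ[ℂ] ℂ) : T [⋀^Fin k]→ₗ[ℂ] ℂ :=
  (Matrix.detRowAlternating (R := ℂ) (n := Fin k)).compLinearMap
    (LinearMap.pi fun i => (AlternatingMap.ofSubsingleton ℂ T ℂ (0 : Fin 1)).symm (α i))

theorem pointwiseWedge_apply {T : Type*} [AddCommGroup T] [Module ℂ T] {k : ℕ}
    (α : Fin k → T [⋀^Fin 1]→ₗ[ℂ] ℂ) (v : Fin k → T) :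
    pointwiseWedge α v = Matrix.det (Matrix.of fun i j => α i (fun _ => v j)) := by
  rw [← Matrix.det_transpose]
  rfl

theorem HasLogPoles.wedge {D : ReducedSNCDivisor n X} {k : ℕ}
    {σ : Fin k → RoughForm n (D.supportᶜ) 1} (hσ : ∀ i, HasLogPoles D (σ i)) :
    HasLogPoles D (fun x => pointwiseWedge fun i => σ i x) := by
  intro e I
  choose f hf hf' using fun i j => hσ i e (fun _ => I j)
  refine ⟨fun z => Matrix.det (Matrix.of fun i j => f i j z), ?_, fun z hz hz' => ?_⟩
  · simp only [Matrix.det_apply, Matrix.of_apply]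
    refine DifferentiableOn.fun_sum fun τ _ => DifferentiableOn.const_smul ?_ _
    exact fun z hz => (HasFDerivWithinAt.finsetProd fun i _ =>
      (hf (τ i) i z hz).hasFDerivWithinAt).differentiableWithinAt
  · rw [pointwiseWedge_apply]
    congr 1
    ext i j
    exact hf' i j z hz hz'

/-- The linear map sending a logarithmic 1-form `σ` to the vector `(σ (v 0), …, σ (v (k - 1)))` of
its values on `k` tangent vectors at a point `x` outside of `D`. -/
def evalVectors (D : ReducedSNCDivisor n X) {k : ℕ} (x : ↥(D.supportᶜ))
    (v : Fin k → TangentSpace 𝓘(ℂ, Model n) (x : X)) : logForms D 1 →ₗ[ℂ] (Fin k → ℂ) where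
  toFun σ j := σ.1 x (fun _ => v j)
  map_add' _ _ := rfl
  map_smul' _ _ := rfl

/-- The wedge product of logarithmic 1-forms, as a logarithmic `k`-form. -/
def wedgeProduct (D : ReducedSNCDivisor n X) {k : ℕ} (σ : Fin k → logForms D 1) : logForms D k :=
  ⟨fun x => pointwiseWedge fun i => (σ i).1 x, HasLogPoles.wedge fun i => (σ i).2⟩

theorem wedgeProduct_apply (D : ReducedSNCDivisor n X) {k : ℕ} (σ : Fin k → logForms D 1)
    (x : ↥(D.supportᶜ)) (v : Fin k → TangentSpace 𝓘(ℂ, Model n) (x : X)) :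
    (wedgeProduct D σ).1 x v =
      Matrix.detRowAlternating.compLinearMap (evalVectors D x v) σ :=
  pointwiseWedge_apply _ _

theorem logForms_ext {D : ReducedSNCDivisor n X} {p : ℕ} {φ η : logForms D p}
    (h : ∀ x v, φ.1 x v = η.1 x v) : φ = η :=
  Subtype.ext (funext fun x => AlternatingMap.ext (h x))

/-- The alternating multilinear map `(σ_1, …, σ_k) ↦ σ_1 ∧ ⋯ ∧ σ_k` on logarithmic 1-forms. -/
def wedge (D : ReducedSNCDivisor n X) (k : ℕ) :
    (logForms D 1) [⋀^Fin k]→ₗ[ℂ] (logForms D k) where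
  toFun σ := wedgeProduct D σ
  map_update_add' := by
    intro inst σ i a b
    obtain rfl : inst = instDecidableEqFin k := Subsingleton.elim _ _
    refine logForms_ext fun x v => ?_
    refine Eq.trans ?_ (congrArg₂ (· + ·) (wedgeProduct_apply D _ x v)
      (wedgeProduct_apply D _ x v)).symm
    rw [wedgeProduct_apply, AlternatingMap.map_update_add]
  map_update_smul' := by
    intro inst σ i c a
    obtain rfl : inst = instDecidableEqFin k := Subsingleton.elim _ _
    refine logForms_ext fun x v => ?_
    refine Eq.trans ?_ (congrArg (c • ·) (wedgeProduct_apply D _ x v)).symm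
    rw [wedgeProduct_apply, AlternatingMap.map_update_smul]
  map_eq_zero_of_eq' := by
    intro σ i j h hij
    refine logForms_ext fun x v => ?_
    rw [wedgeProduct_apply, AlternatingMap.map_eq_zero_of_eq _ _ h hij]
    rfl

/-- The natural map `Λ^k V → H⁰(X, Ω^k_X(log D))`. -/
def wedgeMap {D : ReducedSNCDivisor n X} (V : Submodule ℂ (logForms D 1)) (k : ℕ) :
    ⋀[ℂ]^k V →ₗ[ℂ] logForms D k :=
  exteriorPower.alternatingMapLinearEquiv ((wedge D k).compLinearMap V.subtype)

/-- Strict `k`-wedge subspaces of `H⁰(X, Ω¹_X(log D))`. -/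
structure IsStrictWedgeSubspace {D : ReducedSNCDivisor n X} (k : ℕ)
    (V : Submodule ℂ (logForms D 1)) : Prop where
  lt_rank : (k : Cardinal) < Module.rank ℂ V
  injective : Function.Injective (wedgeMap V k)
  eq_zero : wedgeMap V (k + 1) = 0

end LogForms

end

/-! Among the independent families in `V` with vanishing wedge product, take a shortest one, of
length `k + 1`. One exists because any `n + 1` forms wedge to zero, and `k ≥ 1` because a nonzero
form is not killed. Let `V'` be its span. The top power of `V'` is the line through the product of
the family, so it maps to zero. In the power of degree `k`, one below the top, every element is
decomposable (`exteriorPower.exists_eq_smul_ιMulti`). A nonzero kernel element would thus give `k`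
independent forms in `V` with zero wedge, against minimality. -/

open Function in
/-- Expansion of an alternating map on a family translated by multiples of one vector. -/
theorem AlternatingMap.map_add_smul_const {R M N : Type*} [CommRing R] [AddCommGroup M]
    [Module R M] [AddCommGroup N] [Module R N] {ι : Type*} [DecidableEq ι] [Fintype ι]
    (g : M [⋀^ι]→ₗ[R] N) (v : ι → M) (b : ι → R) (u : M) :
    g (fun i => v i + b i • u) = g v + ∑ i, b i • g (update v i u) := by
  have h := g.toMultilinearMap.map_add_eq_map_add_linearDeriv_add v fun i => b i • u
  rw [MultilinearMap.linearDeriv_apply] at h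
  -- The terms of order at least two contain `u` twice.
  have h0 : ∑ s : Finset ι with 2 ≤ s.card,
      g.toMultilinearMap (s.piecewise (fun i => b i • u) v) = 0 := by
    refine Finset.sum_eq_zero fun s hs => ?_
    obtain ⟨i, hi, j, hj, hij⟩ := Finset.one_lt_card.mp (Finset.mem_filter.mp hs).2
    have e : s.piecewise (fun i => b i • u) v =
        s.piecewise (fun i => b i • (s.piecewise (fun _ => u) v) i) (s.piecewise (fun _ => u) v) := by
      ext l
      by_cases hl : l ∈ s <;> simp [hl]
    rw [e, MultilinearMap.map_piecewise_smul]
    have : g (s.piecewise (fun _ => u) v) = 0 :=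
      g.map_eq_zero_of_eq _ (by simp [hi, hj]) hij
    simp [this]
  rw [h0, add_zero] at h
  simpa [Pi.add_def] using h

/-! ### Exterior powers one below the top degree -/

namespace exteriorPower

open Module

variable {K W : Type*} [Field K] [AddCommGroup W] [Module K W] {k : ℕ}

/-- If `t` omits the index `j`, then `v ∘ t` has the same exterior product, up to sign, as `v` with
the `j`-th vector removed. -/
theorem exists_ιMulti_comp_eq_smul_succAbove (v : Fin (k + 1) → W) (t : Fin k → Fin (k + 1))
    (ht : Function.Injective t) (j : Fin (k + 1)) (hj : ∀ i, t i ≠ j) :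
    ∃ ε : ℤˣ, ιMulti K k (v ∘ j.succAbove) = ε • ιMulti K k (v ∘ t) := by
  choose s hs using fun i => Fin.exists_succAbove_eq (hj i)
  have hinj : Function.Injective s := fun a b h => ht (by rw [← hs a, ← hs b, h])
  let τ : Equiv.Perm (Fin k) := Equiv.ofBijective s (Finite.injective_iff_bijective.mp hinj)
  refine ⟨Equiv.Perm.sign τ, ?_⟩
  have e : v ∘ t = (v ∘ j.succAbove) ∘ τ := funext fun i => congrArg v (hs i).symm
  rw [e, AlternatingMap.map_perm, smul_smul, Int.units_mul_self, one_smul]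

/-- The exterior products of `k` out of `k + 1` spanning vectors span the `k`-th exterior power. -/
theorem span_range_ιMulti_comp_succAbove {v : Fin (k + 1) → W}
    (hv : Submodule.span K (Set.range v) = ⊤) :
    Submodule.span K (Set.range fun j : Fin (k + 1) => ιMulti K k (v ∘ j.succAbove)) = ⊤ := by
  rw [eq_top_iff, ← ιMulti_family_span_of_span K hv, Submodule.span_le]
  rintro _ ⟨s, rfl⟩
  have ht := (Set.powersetCard.ofFinEmbEquiv.symm s).injective
  obtain ⟨j, hj⟩ : ∃ j, ∀ i, Set.powersetCard.ofFinEmbEquiv.symm s i ≠ j := by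
    by_contra! h
    simpa using Fintype.card_le_of_surjective _ h
  obtain ⟨ε, hε⟩ := exists_ιMulti_comp_eq_smul_succAbove (K := K) v _ ht j hj
  rw [ιMulti_family, ← inv_smul_eq_iff.mpr hε]
  have hmem := Submodule.subset_span (R := K)
    (Set.mem_range_self (f := fun j : Fin (k + 1) => ιMulti K k (v ∘ j.succAbove)) j)
  rcases Int.units_eq_one_or ε⁻¹ with h | h <;> rw [h]
  · simpa using hmem
  · simpa using neg_mem hmem

/-- In the `k`-th exterior power of a vector space spanned by `k + 1` vectors, every element is
decomposable. -/
theorem exists_eq_smul_ιMulti {v : Fin (k + 1) → W} (hv : Submodule.span K (Set.range v) = ⊤)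
    (x : ⋀[K]^k W) : ∃ (c : K) (w : Fin k → W), x = c • ιMulti K k w := by
  have hx : x ∈ Submodule.span K
      (Set.range fun j : Fin (k + 1) => ιMulti K k (v ∘ j.succAbove)) := by
    rw [span_range_ιMulti_comp_succAbove hv]; trivial
  obtain ⟨a, rfl⟩ := (Submodule.mem_span_range_iff_exists_fun K).mp hx
  by_cases ha : ∀ j, a j = 0
  · exact ⟨0, 0, by simp [ha]⟩
  push Not at ha
  obtain ⟨j, hj⟩ := ha
  -- Omitting another vector instead of `v j` amounts, up to order, to putting `v j` in its place.
  have hup (i : Fin k) : ∃ ε : ℤˣ, ιMulti K k (v ∘ (j.succAbove i).succAbove) =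
      ε • ιMulti K k (Function.update (v ∘ j.succAbove) i (v j)) := by
    rw [← Function.comp_update]
    refine exists_ιMulti_comp_eq_smul_succAbove v _ ?_ _ fun l => ?_
    · intro p q h
      have := Fin.succAbove_ne j
      have hinj := Fin.succAbove_right_injective (p := j)
      by_cases hp : p = i <;> by_cases hq : q = i <;> simp_all
    · have := Fin.succAbove_ne j i
      by_cases hl : l = i <;> simp_all
  choose ε hε using hup
  -- Translating by multiples of `v j` creates no terms beyond first order, so these multiples can
  -- be read off from the coefficients of `x`, normalised by `a j ≠ 0`.
  refine ⟨a j, fun i => (v ∘ j.succAbove) i + ((a j)⁻¹ * a (j.succAbove i) * (ε i : ℤ)) • v j, ?_⟩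
  rw [AlternatingMap.map_add_smul_const, smul_add, Finset.smul_sum, Fin.sum_univ_succAbove _ j]
  congr 1
  refine Finset.sum_congr rfl fun i _ => ?_
  rw [hε i, smul_smul, mul_assoc, mul_inv_cancel_left₀ hj, Units.smul_def, mul_smul,
    Int.cast_smul_eq_zsmul]

variable {E : Type*} [AddCommGroup E] [Module K E]

/-- Let `g` be an alternating map in `k` variables that does not vanish on independent families in
the span of `k + 1` vectors. Then the induced map on the `k`-th exterior power of the span is
injective. -/
theorem alternatingMapLinearEquiv_span_injective {N : Type*} [AddCommGroup N] [Module K N]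
    (g : E [⋀^Fin k]→ₗ[K] N) {v : Fin (k + 1) → E} (hv : LinearIndependent K v)
    (hmin : ∀ w : Fin k → E, LinearIndependent K w →
      (∀ i, w i ∈ Submodule.span K (Set.range v)) → g w ≠ 0) :
    Function.Injective (alternatingMapLinearEquiv
      (g.compLinearMap (Submodule.span K (Set.range v)).subtype)) := by
  rw [injective_iff_map_eq_zero]
  intro x hx
  by_contra hx0
  obtain ⟨c, w, rfl⟩ := exists_eq_smul_ιMulti (Basis.span hv).span_eq x
  obtain ⟨hc, hw⟩ := smul_ne_zero_iff.mp hx0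
  have hwi : LinearIndependent K w := by
    by_contra h
    exact hw (AlternatingMap.map_linearDependent _ _ h)
  rw [map_smul, alternatingMapLinearEquiv_apply_ιMulti] at hx
  exact hmin _ (hwi.map' _ (Submodule.ker_subtype _)) (fun i => (w i).2)
    ((smul_eq_zero.mp hx).resolve_left hc)

/-- An alternating map in `k` variables that vanishes on `k` independent vectors vanishes on their
span. -/
theorem _root_.AlternatingMap.compLinearMap_span_subtype_eq_zero {N : Type*} [AddCommGroup N]
    [Module K N] (g : E [⋀^Fin k]→ₗ[K] N) {v : Fin k → E} (hv : LinearIndependent K v)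
    (h0 : g v = 0) : g.compLinearMap (Submodule.span K (Set.range v)).subtype = 0 := by
  -- Only injective choices of basis vectors matter, and these are permutations of `v`.
  refine Basis.ext_alternating (Basis.span hv) fun t ht => ?_
  let τ := Equiv.ofBijective t (Finite.injective_iff_bijective.mp ht)
  have e : (fun i => (Submodule.span K (Set.range v)).subtype (Basis.span hv (t i))) = v ∘ τ :=
    funext fun i => congrArg Subtype.val (Basis.span_apply hv (t i))
  refine (congrArg g e).trans ?_
  rw [AlternatingMap.map_perm, h0, smul_zero]
  rfl

/-- Let `g k` be alternating maps in `k` variables such that `g 1` is injective and `g (n + 1)`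
vanishes. Then every subspace `V` of dimension greater than `n` contains a subspace of some
dimension `k + 1 ≥ 2` such that `g k` is injective on its `k`-th exterior power and `g (k + 1)`
vanishes on it. -/
theorem exists_submodule_injective_and_eq_zero {N : ℕ → Type*} [∀ k, AddCommGroup (N k)]
    [∀ k, Module K (N k)] (g : ∀ k, E [⋀^Fin k]→ₗ[K] N k) (h1 : ∀ w, g 1 w = 0 → w 0 = 0) {n : ℕ}
    (hn : ∀ w, g (n + 1) w = 0) (V : Submodule K E) (hV : (n : Cardinal) < Module.rank K V) :
    ∃ k : ℕ, 1 ≤ k ∧ ∃ W : Submodule K E, W ≤ V ∧ Module.rank K W = (k + 1 : ℕ) ∧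
      Function.Injective (alternatingMapLinearEquiv ((g k).compLinearMap W.subtype)) ∧
      (g (k + 1)).compLinearMap W.subtype = 0 := by
  classical
  -- The shift by one excludes the empty family and makes the least `k` the required degree.
  let P (k : ℕ) : Prop := ∃ v : Fin (k + 1) → E,
    LinearIndependent K v ∧ (∀ i, v i ∈ V) ∧ g (k + 1) v = 0
  have hP : ∃ k, P k := by
    have hle : ((n + 1 : ℕ) : Cardinal) ≤ Module.rank K V := by
      rw [Nat.cast_succ, ← Cardinal.succ_natCast]
      exact Order.succ_le_of_lt hV
    obtain ⟨w, hw⟩ := exists_linearIndependent_of_le_rank hle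
    exact ⟨n, fun i => w i, hw.map' _ (Submodule.ker_subtype _), fun i => (w i).2, hn _⟩
  obtain ⟨v, hv, hvV, h0⟩ := Nat.find_spec hP
  have hmin (m : ℕ) : m < Nat.find hP → ¬ P m := Nat.find_min hP
  generalize Nat.find hP = k at v hv hvV h0 hmin
  have hspan : Submodule.span K (Set.range v) ≤ V :=
    Submodule.span_le.mpr (Set.range_subset_iff.mpr hvV)
  obtain _ | k := k
  · exact absurd (h1 v h0) (hv.ne_zero 0)
  · refine ⟨k + 1, by omega, Submodule.span K (Set.range v), hspan, ?_,
      alternatingMapLinearEquiv_span_injective _ hv fun w hw hwV hw0 =>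
        hmin k k.lt_succ_self ⟨w, hw, fun i => hspan (hwV i), hw0⟩,
      AlternatingMap.compLinearMap_span_subtype_eq_zero _ hv h0⟩
    rw [rank_eq_card_basis (Basis.span hv), Fintype.card_fin]

end exteriorPower

/-! ### Wedge products of logarithmic forms -/

namespace LogForms

variable {n : ℕ} {X : Type*} [TopologicalSpace X] [ChartedSpace (Model n) X]

/-- On an `n`-dimensional manifold the wedge product of more than `n` forms vanishes. -/
theorem wedge_eq_zero_of_lt (D : ReducedSNCDivisor n X) {k : ℕ} (hk : n < k)
    (σ : Fin k → logForms D 1) : wedge D k σ = 0 := by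
  refine logForms_ext fun x v => ?_
  -- The dependence is among the `k > n` tangent vectors at `x`, not among the forms.
  refine AlternatingMap.map_linearDependent (K := ℂ) (M := Model n) _ v fun h => ?_
  have := h.fintype_card_le_finrank
  simp at this
  omega

theorem wedge_one_apply (D : ReducedSNCDivisor n X) (σ : Fin 1 → logForms D 1)
    (x : ↥(D.supportᶜ)) (v : Fin 1 → TangentSpace 𝓘(ℂ, Model n) (x : X)) :
    (wedge D 1 σ).1 x v = (σ 0).1 x v := by
  refine (pointwiseWedge_apply _ _).trans ?_
  rw [Matrix.det_fin_one, Matrix.of_apply]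
  exact congrArg _ (funext fun i => by rw [Subsingleton.elim i 0])

end LogForms

theorem proposition6p5 (n : ℕ) (X : Type*) [TopologicalSpace X] [T2Space X] [CompactSpace X]
    [ChartedSpace (LogForms.Model n) X] [IsManifold 𝓘(ℂ, LogForms.Model n) ω X]
    (D : LogForms.ReducedSNCDivisor n X) (V : Submodule ℂ (LogForms.logForms D 1))
    (hV : (n : Cardinal) < Module.rank ℂ V) :
    ∃ k : ℕ, 1 ≤ k ∧ ∃ V' : Submodule ℂ (LogForms.logForms D 1),
      V' ≤ V ∧ LogForms.IsStrictWedgeSubspace k V' ∧ Module.finrank ℂ V' = k + 1 := by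
  obtain ⟨k, hk, W, hWV, hrank, hinj, hzero⟩ :=
    exteriorPower.exists_submodule_injective_and_eq_zero (LogForms.wedge D)
      (fun w hw => LogForms.logForms_ext fun x u => by
        rw [← LogForms.wedge_one_apply, hw])
      (LogForms.wedge_eq_zero_of_lt D n.lt_succ_self) V hV
  refine ⟨k, hk, W, hWV, ⟨?_, hinj, ?_⟩, Module.finrank_eq_of_rank_eq hrank⟩
  · rw [hrank]
    exact_mod_cast k.lt_succ_self
  · exact (congrArg exteriorPower.alternatingMapLinearEquiv hzero).trans
      (LinearEquiv.map_zero exteriorPower.alternatingMapLinearEquiv)
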